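/- Let $\mathcal X\subset\mathbb R^m$ carry the Euclidean distance, let $f:\mathcal X\to\mathcal X$ be measurable, and let $\nu$ be an $f$-invariant ergodic Borel probability measure on $\mathcal X$ (for example an ergodic SRB measure). Let $\tilde x\in\mathcal X$ and write $B(\tilde x,r)$ for the ball of radius $r$ in $\mathcal X$. Assume: * (local dimension) $\nu(B(\tilde x,r))>0$ for all $r>0$, and the limit $d_\nu=\lim_{r\to0^+}\frac{\log\nu(B(\tilde x,r))}{\log r}$ exists with $0<d_\nu<\infty$; * (A2) for some $\delta>0$ there are $C$ and $r_0>0$ such that $|\nu(B(\tilde x,r+\epsilon))-\nu(B(\tilde x,r))|\le C\epsilon^{\delta}$ whenever $0<\epsilon<r<r_0$; * (A1) there is a monotonically decreasing sequence $\Theta(j)\to0$ such that for all $j\ge 0$ and all bounded Lipschitz $\varphi_1,\varphi_2:\mathcal X\to\mathbb R$, $$\Big|\int\varphi_1\cdot\varphi_2\circ f^j\,d\nu-\int\varphi_1\,d\nu\int\varphi_2\,d\nu\Big|\le\Theta(j)\,\|\varphi_1\|_{\mathrm{Lip}}\,\|\varphi_2\|_{\mathrm{Lip}},$$ where $\|\varphi\|_{\mathrm{Lip}}$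 is the sum of $\sup|\varphi|$ and the best Lipschitz constant of $\varphi$. Let $\alpha>0$, $\phi(x)=\operatorname{dist}(x,\tilde x)^{-\alpha}$ (with $\phi(\tilde x)=\infty$) and $M_n(x)=\max_{0\le i<n}\phi(f^i(x))$. Then: 1. If $\Theta(n)=O(\theta_0^n)$ for some $0<\theta_0<1$, then for every $\epsilon>0$ and for $\nu$-a.e. $x$ one has, for all sufficiently large $n$ (depending on $x$ and $\epsilon$), $$n^{\frac{\alpha}{d_\nu}-\epsilon}\le M_n(x)\le n^{\frac{\alpha}{d_\nu}+\epsilon}.$$ 2. If $\Theta(n)=O(n^{-\zeta})$ for some $\zeta>2/\delta$, then there exists $\beta>0$ such that for every $\epsilon>0$ and for $\nu$-a.e. $x$ one has, for all sufficiently large $n$ (depending on $x$ and $\epsilon$), $$n^{\frac{\beta\alpha}{d_\nu}-\epsilon}\le M_n(x)\le n^{\frac{\alpha}{d_\nu}+\epsilon}.$$ -/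

import Mathlib

open MeasureTheory Filter Asymptotics
open scoped Topology ENNReal

noncomputable section

namespace AlmostSureMaxima

variable {X : Type*} [MetricSpace X]

/-- The Lipschitz norm `‖φ‖_Lip = sup |φ| + Lip(φ)`, where `Lip(φ)` is the best Lipschitz constant.
It is only evaluated at bounded Lipschitz functions. -/
def lipNorm (φ : X → ℝ) : ℝ :=
  (⨆ x, |φ x|) + sInf {K : ℝ | 0 ≤ K ∧ ∀ x y, |φ x - φ y| ≤ K * dist x y}

/-- `φ` is a function of finite Lipschitz norm: it is Lipschitz and bounded. -/
def IsBoundedLipschitz (φ : X → ℝ) : Prop :=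
  (∃ K : NNReal, LipschitzWith K φ) ∧ ∃ M : ℝ, ∀ x, |φ x| ≤ M

/-- The observable `φ(x) = dist(x, xt)^(-α)`, with the value `∞` at `x = xt`. -/
def powerDist (xt : X) (α : ℝ) (x : X) : ℝ≥0∞ :=
  edist x xt ^ (-α)

/-- The maximum process `M_n = max(X_1, …, X_n)`, where `X_i = φ ∘ f^(i-1)`. -/
def maxProcess (f : X → X) (φ : X → ℝ≥0∞) (n : ℕ) (x : X) : ℝ≥0∞ :=
  (Finset.range n).sup fun i => φ (f^[i] x)

variable [MeasurableSpace X]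

/-- The correlation `|∫ φ₁ · φ₂ ∘ f^j dν - ∫ φ₁ dν ∫ φ₂ dν|`. -/
def correlation (f : X → X) (ν : Measure X) (j : ℕ) (φ₁ φ₂ : X → ℝ) : ℝ :=
  |∫ x, φ₁ x * φ₂ (f^[j] x) ∂ν - (∫ x, φ₁ x ∂ν) * ∫ x, φ₂ x ∂ν|

/-- Decay of correlations for Lipschitz observables with rate function `Θ`, where `Θ` decreases
monotonically to zero. -/
structure DecayOfCorrelations (f : X → X) (ν : Measure X) (Θ : ℕ → ℝ) : Prop where
  antitone : Antitone Θ
  tendsto_zero : Tendsto Θ atTop (𝓝 0)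
  bound : ∀ (j : ℕ) (φ₁ φ₂ : X → ℝ), IsBoundedLipschitz φ₁ → IsBoundedLipschitz φ₂ →
    correlation f ν j φ₁ φ₂ ≤ Θ j * lipNorm φ₁ * lipNorm φ₂

/-- The pointwise dimension `lim_{r → 0} log ν(B(x,r)) / log r` exists and is the real number `D`.
Balls about `x` have positive measure, so that the logarithms are genuine. -/
structure HasLocalDimension (ν : Measure X) (x : X) (D : ℝ) : Prop where
  ball_pos : ∀ r : ℝ, 0 < r → 0 < ν.real (Metric.ball x r)
  tendsto : Tendsto (fun r : ℝ => Real.log (ν.real (Metric.ball x r)) / Real.log r)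
    (𝓝[>] 0) (𝓝 D)

/-- Regularity of `ν` on shrinking annuli about `x`, with exponent `δ`. -/
def AnnulusRegular (ν : Measure X) (x : X) (δ : ℝ) : Prop :=
  0 < δ ∧ ∃ C r₀ : ℝ, 0 < r₀ ∧ ∀ ε r : ℝ, 0 < ε → ε < r → r < r₀ →
    |ν.real (Metric.ball x (r + ε)) - ν.real (Metric.ball x r)| ≤ C * ε ^ δ

end AlmostSureMaxima

end

namespace AlmostSureMaxima

/-! `M_n` exceeds `u` exactly when some iterate before time `n` is within `u ^ (-1/α)` of `xt`, so
the claim concerns visits to shrinking balls. Upper bound: if `s > α / d`, the balls of radius `n ^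
(-(s/α))` have summable measure, and by invariance and Borel–Cantelli the `n`-th iterate eventually
misses the `n`-th ball. Lower bound: apply Chebyshev to the centred Birkhoff sum of a Lipschitz
cutoff with mean `p`. An orbit that avoids the ball makes this sum equal `-(n * p)`, and decay of
correlations bounds its second moment (`measureReal_avoiding_le`). Avoidance probabilities at radius
`n ^ (-c)` then decay like a power of `n`; Borel–Cantelli along `n = 2 ^ k` and monotonicity of
`M_n` finish. The cutoff's Lipschitz norm is of order `1 / r`, too costly for the sharp exponent.
Raising the correlation bound to a small power `η` makes this cost negligible; exponential decay
survives that, while polynomial decay is used with `η = 1`. -/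

lemma le_maxProcess {X : Type*} (f : X → X) (φ : X → ℝ≥0∞) (x : X) {i n : ℕ} (h : i < n) :
    φ (f^[i] x) ≤ maxProcess f φ n x :=
  Finset.le_sup (f := fun i => φ (f^[i] x)) (Finset.mem_range.2 h)

lemma DecayOfCorrelations.nonneg {X : Type*} [MetricSpace X] [MeasurableSpace X] {f : X → X}
    {ν : Measure X} {Θ : ℕ → ℝ} (h : DecayOfCorrelations f ν Θ) (j : ℕ) : 0 ≤ Θ j :=
  h.antitone.le_of_tendsto h.tendsto_zero j

/-! ### Power bounds for ball measures from the local dimension. -/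

section LocalDimension

variable {X : Type*} [MetricSpace X] [MeasurableSpace X] {ν : Measure X} {x : X} {d : ℝ}

lemma HasLocalDimension.rpow_le_ball (h : HasLocalDimension ν x d) {D : ℝ} (hD : d < D) :
    ∀ᶠ r in 𝓝[>] (0 : ℝ), r ^ D ≤ ν.real (Metric.ball x r) := by
  have h1 : ∀ᶠ r in 𝓝[>] (0 : ℝ), r < 1 := nhdsWithin_le_nhds (Iio_mem_nhds one_pos)
  filter_upwards [h.tendsto.eventually (gt_mem_nhds hD), h1, self_mem_nhdsWithin]
    with r hr hr1 (hr0 : 0 < r)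
  have hlog : Real.log r < 0 := Real.log_neg hr0 hr1
  rw [div_lt_iff_of_neg hlog] at hr
  rw [← Real.log_le_log_iff (Real.rpow_pos_of_pos hr0 _) (h.ball_pos r hr0), Real.log_rpow hr0]
  exact hr.le

lemma HasLocalDimension.ball_le_rpow (h : HasLocalDimension ν x d) {D : ℝ} (hD : D < d) :
    ∀ᶠ r in 𝓝[>] (0 : ℝ), ν.real (Metric.ball x r) ≤ r ^ D := by
  have h1 : ∀ᶠ r in 𝓝[>] (0 : ℝ), r < 1 := nhdsWithin_le_nhds (Iio_mem_nhds one_pos)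
  filter_upwards [h.tendsto.eventually (lt_mem_nhds hD), h1, self_mem_nhdsWithin]
    with r hr hr1 (hr0 : 0 < r)
  have hlog : Real.log r < 0 := Real.log_neg hr0 hr1
  rw [lt_div_iff_of_neg hlog] at hr
  rw [← Real.log_le_log_iff (h.ball_pos r hr0) (Real.rpow_pos_of_pos hr0 _), Real.log_rpow hr0]
  exact hr.le

/-- Needed so that almost every orbit never meets `xt`, where the observable is infinite. -/
lemma HasLocalDimension.measure_singleton [IsFiniteMeasure ν] (h : HasLocalDimension ν x d)
    (hd : 0 < d) : ν {x} = 0 := by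
  have hev := h.ball_le_rpow (half_lt_self hd)
  have hlim : Tendsto (fun r : ℝ => r ^ (d / 2)) (𝓝[>] 0) (𝓝 0) := by
    have := (Real.continuousAt_rpow_const 0 (d / 2) (Or.inr (by positivity))).tendsto
    rw [Real.zero_rpow (by positivity)] at this
    exact this.mono_left nhdsWithin_le_nhds
  have hle : ν.real {x} ≤ 0 := by
    refine ge_of_tendsto hlim ?_
    filter_upwards [hev, self_mem_nhdsWithin] with r hr (hr0 : 0 < r)
    exact (measureReal_mono (Set.singleton_subset_iff.2 (Metric.mem_ball_self hr0))).trans hr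
  exact (measureReal_eq_zero_iff).1 (le_antisymm hle measureReal_nonneg)

end LocalDimension

/-! ### Size of the observable versus distance to `xt`. -/

section Observable

variable {X : Type*} [MetricSpace X]

lemma powerDist_eq_ofReal {xt x : X} {α : ℝ} (h : x ≠ xt) :
    powerDist xt α x = ENNReal.ofReal (dist x xt ^ (-α)) := by
  rw [powerDist, edist_dist, ENNReal.ofReal_rpow_of_pos (dist_pos.2 h)]

lemma natCast_rpow_eq_ofReal {n : ℕ} (hn : 0 < n) (s : ℝ) :
    (n : ℝ≥0∞) ^ s = ENNReal.ofReal ((n : ℝ) ^ s) := by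
  rw [← ENNReal.ofReal_rpow_of_pos (by exact_mod_cast hn), ENNReal.ofReal_natCast]

lemma powerDist_le {xt x : X} {α s : ℝ} (hα : 0 < α) {n : ℕ} (hn : 0 < n)
    (h : (n : ℝ) ^ (-(s / α)) ≤ dist x xt) : powerDist xt α x ≤ (n : ℝ≥0∞) ^ s := by
  have hn' : (0 : ℝ) < n := by exact_mod_cast hn
  have hpos : 0 < (n : ℝ) ^ (-(s / α)) := Real.rpow_pos_of_pos hn' _
  rw [powerDist_eq_ofReal (dist_pos.1 (hpos.trans_le h)), natCast_rpow_eq_ofReal hn]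
  refine ENNReal.ofReal_le_ofReal ?_
  refine (Real.rpow_le_rpow_of_nonpos hpos h (by linarith)).trans_eq ?_
  rw [← Real.rpow_mul hn'.le]
  congr 1
  field_simp

lemma le_powerDist {xt x : X} {α s : ℝ} (hα : 0 < α) {n : ℕ} (hn : 0 < n)
    (h : dist x xt ≤ (n : ℝ) ^ (-(s / α))) : (n : ℝ≥0∞) ^ s ≤ powerDist xt α x := by
  have hn' : (0 : ℝ) < n := by exact_mod_cast hn
  rcases eq_or_ne x xt with rfl | hx
  · simp [powerDist, ENNReal.zero_rpow_of_neg (neg_lt_zero.2 hα)]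
  rw [powerDist_eq_ofReal hx, natCast_rpow_eq_ofReal hn]
  refine ENNReal.ofReal_le_ofReal ?_
  refine Eq.trans_le ?_ (Real.rpow_le_rpow_of_nonpos (dist_pos.2 hx) h (by linarith))
  rw [← Real.rpow_mul hn'.le]
  congr 1
  field_simp

end Observable

/-! ### Upper bound by Borel–Cantelli. -/

section UpperBound

variable {X : Type*} [MetricSpace X] [MeasurableSpace X] [OpensMeasurableSpace X]
  {f : X → X} {ν : Measure X} [IsFiniteMeasure ν] {xt : X} {d α s : ℝ}

/-- Along almost every orbit the maximum is eventually at most `n ^ s` for every `s > α / d`. -/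
theorem ae_eventually_maxProcess_le (hf : MeasurePreserving f ν ν)
    (hdim : HasLocalDimension ν xt d) (hd : 0 < d) (hα : 0 < α) (hs : α / d < s) :
    ∀ᵐ x ∂ν, ∀ᶠ n : ℕ in atTop, maxProcess f (powerDist xt α) n x ≤ (n : ℝ≥0∞) ^ s := by
  have hs0 : 0 < s := (div_pos hα hd).trans hs
  have hsα : 0 < s / α := div_pos hs0 hα
  -- A dimension `D` below `d` still large enough that `n ^ (-(s/α) * D)` is summable.
  obtain ⟨D, hD1, hD2⟩ : ∃ D, α / s < D ∧ D < d :=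
    exists_between (by rw [div_lt_iff₀ hs0]; rwa [div_lt_iff₀ hd, mul_comm] at hs)
  have hexp : 1 < s / α * D := by
    rw [div_lt_iff₀ hs0] at hD1
    rw [div_mul_eq_mul_div, one_lt_div hα]
    linarith
  let r : ℕ → ℝ := fun n => (n : ℝ) ^ (-(s / α))
  have hr : Tendsto r atTop (𝓝[>] 0) := by
    refine tendsto_nhdsWithin_iff.2
      ⟨(tendsto_rpow_neg_atTop hsα).comp tendsto_natCast_atTop_atTop, ?_⟩
    filter_upwards [eventually_gt_atTop 0] with n hn
    exact Real.rpow_pos_of_pos (by exact_mod_cast hn) _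
  have hmeas : ∀ n, ν.real (f^[n] ⁻¹' Metric.ball xt (r n)) = ν.real (Metric.ball xt (r n)) :=
    fun n => (hf.iterate n).measureReal_preimage Metric.isOpen_ball.measurableSet.nullMeasurableSet
  have hsum : Summable fun n => ν.real (f^[n] ⁻¹' Metric.ball xt (r n)) := by
    refine summable_of_isBigO_nat (Real.summable_nat_rpow.2 (neg_lt_neg hexp)) ?_
    refine IsBigO.of_bound 1 ?_
    filter_upwards [hr.eventually (hdim.ball_le_rpow hD2)] with n hn
    rw [hmeas, one_mul, Real.norm_of_nonneg measureReal_nonneg,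
      Real.norm_of_nonneg (Real.rpow_nonneg n.cast_nonneg _)]
    refine hn.trans_eq ?_
    rw [← Real.rpow_mul n.cast_nonneg, neg_mul]
  have hBC : ∀ᵐ x ∂ν, ∀ᶠ n in atTop, x ∉ f^[n] ⁻¹' Metric.ball xt (r n) := by
    refine ae_eventually_notMem ?_
    have := hsum.tsum_ofReal_ne_top
    simpa only [measureReal_def, ENNReal.ofReal_toReal (measure_ne_top ν _)] using this
  have hne : ∀ᵐ x ∂ν, ∀ n, f^[n] x ≠ xt := by
    refine ae_all_iff.2 fun n =>
      (hf.iterate n).quasiMeasurePreserving.ae (p := fun y => y ≠ xt) ?_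
    exact measure_eq_zero_iff_ae_notMem.1 (hdim.measure_singleton hd)
  filter_upwards [hBC, hne] with x hx hx'
  obtain ⟨N, hN⟩ := eventually_atTop.1 hx
  -- Borel–Cantelli says nothing about the first `N` iterates; their maximum is finite, hence
  -- eventually below `n ^ s`. Each later `i < n` contributes at most `i ^ s ≤ n ^ s`.
  have hfin : maxProcess f (powerDist xt α) (N + 1) x < ∞ := by
    refine (Finset.sup_lt_iff (by simp)).2 fun i _ => ?_
    rw [powerDist_eq_ofReal (hx' i)]
    exact ENNReal.ofReal_lt_top
  have hlim : Tendsto (fun n : ℕ => (n : ℝ≥0∞) ^ s) atTop (𝓝 ∞) := by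
    have := (ENNReal.continuous_rpow_const (y := s)).tendsto ∞
    rw [ENNReal.top_rpow_of_pos hs0] at this
    exact this.comp ENNReal.tendsto_nat_nhds_top
  filter_upwards [hlim.eventually (lt_mem_nhds hfin)] with n hn
  refine Finset.sup_le fun i hi => ?_
  rw [Finset.mem_range] at hi
  rcases lt_or_ge i (N + 1) with hiN | hiN
  · exact (le_maxProcess f _ x hiN).trans hn.le
  · have hmem := hN i (by omega)
    rw [Set.mem_preimage, Metric.mem_ball, not_lt] at hmem
    refine (powerDist_le hα (by omega) hmem).trans ?_
    exact ENNReal.rpow_le_rpow (by exact_mod_cast hi.le) hs0.le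

end UpperBound

/-! ### Second moments of Birkhoff sums. -/

section SecondMoment

variable {X : Type*} [MeasurableSpace X] {f : X → X} {ν : Measure X} [IsProbabilityMeasure ν]

/-- The second moment of a Birkhoff sum is controlled by upper bounds on the autocorrelations. -/
lemma integral_birkhoffSum_sq_le (hf : MeasurePreserving f ν ν) {g : X → ℝ} (hg : Measurable g)
    {M : ℝ} (hM : ∀ x, |g x| ≤ M) {D : ℕ → ℝ} (hD0 : ∀ j, 0 ≤ D j)
    (hD : ∀ j, ∫ x, g x * g (f^[j] x) ∂ν ≤ D j) (n : ℕ) :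
    ∫ x, birkhoffSum f g n x ^ 2 ∂ν ≤ 2 * n * ∑ j ∈ Finset.range n, D j := by
  have hmeas : ∀ j, Measurable fun x => g (f^[j] x) := fun j => hg.comp (hf.measurable.iterate j)
  have hBmeas : ∀ n, Measurable (birkhoffSum f g n) := fun n =>
    Finset.measurable_sum _ fun j _ => hmeas j
  have hBbd : ∀ n x, |birkhoffSum f g n x| ≤ n * M := fun n x => by
    refine (Finset.abs_sum_le_sum_abs _ _).trans ?_
    refine (Finset.sum_le_card_nsmul _ _ M fun i _ => hM _).trans_eq ?_
    simp
  have hgg : ∀ j, Integrable (fun x => g x * g (f^[j] x)) ν := fun j => by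
    refine Integrable.of_bound (hg.mul (hmeas j)).aestronglyMeasurable (M * M)
      (ae_of_all _ fun x => ?_)
    rw [norm_mul]
    exact mul_le_mul (hM _) (hM _) (norm_nonneg _) ((abs_nonneg _).trans (hM x))
  have hBB : ∀ n, Integrable (fun x => birkhoffSum f g n x ^ 2) ν := fun n => by
    refine Integrable.of_bound ((hBmeas n).pow_const 2).aestronglyMeasurable ((n * M) ^ 2)
      (ae_of_all _ fun x => ?_)
    rw [norm_pow]
    exact pow_le_pow_left₀ (norm_nonneg _) (hBbd n x) 2
  induction n with
  | zero => simp
  | succ n ih =>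
    -- Splitting off the first term, `S_{n+1} = g + S_n ∘ f`, turns the cross terms into
    -- autocorrelations, and invariance removes the `f` in the last square.
    have hpt : ∀ x, birkhoffSum f g (n + 1) x ^ 2 = g x * g (f^[0] x)
        + 2 * ∑ j ∈ Finset.range n, g x * g (f^[j + 1] x) + birkhoffSum f g n (f x) ^ 2 := by
      intro x
      have : ∑ j ∈ Finset.range n, g x * g (f^[j + 1] x) = g x * birkhoffSum f g n (f x) := by
        simp [birkhoffSum, Finset.mul_sum]
      rw [this, birkhoffSum_succ']
      simp only [Function.iterate_zero, id]
      ring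
    have hcomp : ∫ x, birkhoffSum f g n (f x) ^ 2 ∂ν = ∫ x, birkhoffSum f g n x ^ 2 ∂ν := by
      conv_rhs => rw [← hf.map_eq]
      exact (integral_map hf.measurable.aemeasurable
        ((hBmeas n).pow_const 2).aestronglyMeasurable).symm
    have hsumint : Integrable (fun x => 2 * ∑ j ∈ Finset.range n, g x * g (f^[j + 1] x)) ν :=
      (integrable_finsetSum _ fun j _ => hgg (j + 1)).const_mul 2
    have hlast : Integrable (fun x => birkhoffSum f g n (f x) ^ 2) ν :=
      hf.integrable_comp_of_integrable (hBB n)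
    have hfirst : Integrable (fun x => g x * g (f^[0] x)
        + 2 * ∑ j ∈ Finset.range n, g x * g (f^[j + 1] x)) ν := (hgg 0).add hsumint
    simp only [hpt]
    rw [integral_add hfirst hlast, integral_add (hgg 0) hsumint,
      integral_const_mul, integral_finsetSum _ fun j _ => hgg (j + 1), hcomp]
    have h1 : ∑ j ∈ Finset.range n, ∫ x, g x * g (f^[j + 1] x) ∂ν
        ≤ ∑ j ∈ Finset.range n, D (j + 1) := Finset.sum_le_sum fun j _ => hD (j + 1)
    have h2 : ∑ j ∈ Finset.range (n + 1), D j = ∑ j ∈ Finset.range n, D (j + 1) + D 0 :=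
      Finset.sum_range_succ' _ _
    have h3 : ∑ j ∈ Finset.range n, D j ≤ ∑ j ∈ Finset.range (n + 1), D j := by
      rw [Finset.sum_range_succ]
      linarith [hD0 n]
    have h4 : 2 * (n : ℝ) * ∑ j ∈ Finset.range n, D j
        ≤ 2 * (n : ℝ) * ∑ j ∈ Finset.range (n + 1), D j :=
      mul_le_mul_of_nonneg_left h3 (by positivity)
    push_cast
    linarith [hD 0, hD0 0]

end SecondMoment

/-! ### Lipschitz cutoffs of balls. -/

section Bump

variable {X : Type*} [MetricSpace X]

/-- The Lipschitz cutoff equal to `1` on the ball of radius `r / 2` and to `0` off the ball of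
radius `r`. -/
noncomputable def bump (xt : X) (r : ℝ) (x : X) : ℝ :=
  max 0 (min 1 (2 - 2 / r * dist x xt))

variable {xt : X} {r : ℝ}

lemma bump_nonneg (x : X) : 0 ≤ bump xt r x := le_max_left _ _

lemma bump_le_one (x : X) : bump xt r x ≤ 1 := max_le zero_le_one (min_le_left _ _)

lemma bump_eq_zero (hr : 0 < r) {x : X} (hx : r ≤ dist x xt) : bump xt r x = 0 := by
  refine max_eq_left ((min_le_right _ _).trans ?_)
  have : 2 ≤ 2 / r * dist x xt := by
    rw [div_mul_eq_mul_div, le_div_iff₀ hr]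
    linarith
  linarith

lemma bump_eq_one (hr : 0 < r) {x : X} (hx : dist x xt ≤ r / 2) : bump xt r x = 1 := by
  have : 2 / r * dist x xt ≤ 1 := by
    rw [div_mul_eq_mul_div, div_le_one hr]
    linarith
  rw [bump, min_eq_left (by linarith), max_eq_right zero_le_one]

lemma abs_bump_sub_le (hr : 0 < r) (x y : X) :
    |bump xt r x - bump xt r y| ≤ 2 / r * dist x y := by
  have h1 := abs_max_sub_max_le_max 0 (min 1 (2 - 2 / r * dist x xt)) 0
    (min 1 (2 - 2 / r * dist y xt))
  have h2 := abs_min_sub_min_le_max 1 (2 - 2 / r * dist x xt) 1 (2 - 2 / r * dist y xt)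
  simp only [sub_self, abs_zero, abs_nonneg, max_eq_right] at h1 h2
  refine h1.trans (h2.trans ?_)
  have : 2 - 2 / r * dist x xt - (2 - 2 / r * dist y xt) = 2 / r * (dist y xt - dist x xt) := by
    ring
  rw [this, abs_mul, abs_of_pos (by positivity)]
  refine mul_le_mul_of_nonneg_left ?_ (by positivity)
  rw [dist_comm x y]
  exact abs_dist_sub_le y x xt

lemma isBoundedLipschitz_bump (hr : 0 < r) : IsBoundedLipschitz (bump xt r) := by
  refine ⟨⟨Real.toNNReal (2 / r), LipschitzWith.of_dist_le_mul fun x y => ?_⟩, 1, fun x => ?_⟩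
  · rw [Real.coe_toNNReal _ (by positivity)]
    exact abs_bump_sub_le hr x y
  · rw [abs_of_nonneg (bump_nonneg x)]
    exact bump_le_one x

lemma lipNorm_bump_nonneg : 0 ≤ lipNorm (bump xt r) :=
  add_nonneg (Real.iSup_nonneg fun _ => abs_nonneg _) (Real.sInf_nonneg fun _ h => h.1)

lemma lipNorm_bump_le (hr : 0 < r) (hr1 : r ≤ 1) : lipNorm (bump xt r) ≤ 3 / r := by
  have h1 : (⨆ x, |bump xt r x|) ≤ 1 / r := by
    refine le_trans ?_ ((one_le_div hr).2 hr1)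
    refine Real.iSup_le (fun x => ?_) zero_le_one
    rw [abs_of_nonneg (bump_nonneg x)]
    exact bump_le_one x
  have h2 : sInf {K : ℝ | 0 ≤ K ∧ ∀ x y, |bump xt r x - bump xt r y| ≤ K * dist x y} ≤ 2 / r :=
    csInf_le ⟨0, fun _ h => h.1⟩ ⟨by positivity, abs_bump_sub_le hr⟩
  have h3 : 3 / r = 1 / r + 2 / r := by ring
  rw [h3]
  exact add_le_add h1 h2

lemma continuous_bump (hr : 0 < r) : Continuous (bump xt r) :=
  (isBoundedLipschitz_bump hr).1.elim fun _ h => h.continuous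

end Bump

/-! ### Probability of avoiding a ball. -/

section HittingTime

variable {X : Type*} [MetricSpace X] [MeasurableSpace X] [OpensMeasurableSpace X]
  {f : X → X} {ν : Measure X} [IsProbabilityMeasure ν] {xt : X} {Θ : ℕ → ℝ}

lemma integrable_bump {r : ℝ} (hr : 0 < r) : Integrable (bump xt r) ν :=
  Integrable.of_bound (continuous_bump hr).measurable.aestronglyMeasurable 1
    (ae_of_all _ fun x => by
      rw [Real.norm_of_nonneg (bump_nonneg x)]
      exact bump_le_one x)

lemma measureReal_ball_le_integral_bump {r : ℝ} (hr : 0 < r) :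
    ν.real (Metric.ball xt (r / 2)) ≤ ∫ x, bump xt r x ∂ν := by
  rw [← integral_indicator_one Metric.isOpen_ball.measurableSet]
  refine integral_mono ((integrable_const (1 : ℝ)).indicator Metric.isOpen_ball.measurableSet)
    (integrable_bump hr) fun x => ?_
  by_cases hx : x ∈ Metric.ball xt (r / 2)
  · rw [Set.indicator_of_mem hx, bump_eq_one hr (Metric.mem_ball.1 hx).le]
    rfl
  · rw [Set.indicator_of_notMem hx]
    exact bump_nonneg x

/-- The autocovariance of the cutoff, bounded by interpolation between the trivial estimate and the
one provided by decay of correlations. -/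
lemma integral_bump_sub_mul_le (hf : MeasurePreserving f ν ν) (hΘ : DecayOfCorrelations f ν Θ)
    {r : ℝ} (hr : 0 < r) (hr1 : r ≤ 1) {η : ℝ} (hη : 0 ≤ η) (hη1 : η ≤ 1) (j : ℕ)
    (hp : 0 < ∫ x, bump xt r x ∂ν) :
    ∫ x, (bump xt r x - ∫ y, bump xt r y ∂ν) * (bump xt r (f^[j] x) - ∫ y, bump xt r y ∂ν) ∂ν ≤
      (∫ x, bump xt r x ∂ν) ^ (1 - η) * (9 / r ^ 2 * Θ j) ^ η := by
  set p := ∫ x, bump xt r x ∂ν with hpdef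
  have hint := integrable_bump (ν := ν) (xt := xt) hr
  have hintj : Integrable (fun x => bump xt r (f^[j] x)) ν :=
    (hf.iterate j).integrable_comp_of_integrable hint
  have hprod : Integrable (fun x => bump xt r x * bump xt r (f^[j] x)) ν :=
    hint.mul_bdd (c := 1) hintj.aestronglyMeasurable (ae_of_all _ fun x => by
      rw [Real.norm_of_nonneg (bump_nonneg _)]
      exact bump_le_one _)
  have hpj : ∫ x, bump xt r (f^[j] x) ∂ν = p := by
    rw [hpdef]
    conv_rhs => rw [← (hf.iterate j).map_eq]
    exact (integral_map (hf.iterate j).measurable.aemeasurable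
      (continuous_bump hr).measurable.aestronglyMeasurable).symm
  have hexpand : ∫ x, (bump xt r x - p) * (bump xt r (f^[j] x) - p) ∂ν
      = ∫ x, bump xt r x * bump xt r (f^[j] x) ∂ν - p * p := by
    have : ∀ x, (bump xt r x - p) * (bump xt r (f^[j] x) - p)
        = bump xt r x * bump xt r (f^[j] x) - p * bump xt r x - p * bump xt r (f^[j] x) + p * p :=
      fun x => by ring
    simp only [this]
    have h1 : Integrable (fun x => bump xt r x * bump xt r (f^[j] x) - p * bump xt r x) ν :=
      hprod.sub (hint.const_mul p)
    have h2 : Integrable (fun x => bump xt r x * bump xt r (f^[j] x) - p * bump xt r x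
        - p * bump xt r (f^[j] x)) ν := h1.sub (hintj.const_mul p)
    rw [integral_add h2 (integrable_const _), integral_sub h1 (hintj.const_mul p),
      integral_sub hprod (hint.const_mul p), integral_const_mul, integral_const_mul, hpj,
      ← hpdef, integral_const]
    simp
  rw [hexpand]
  set c := ∫ x, bump xt r x * bump xt r (f^[j] x) ∂ν - p * p with hc
  have hb0 : 0 ≤ 9 / r ^ 2 * Θ j := mul_nonneg (by positivity) (hΘ.nonneg j)
  have hle1 : c ≤ p := by
    have : ∫ x, bump xt r x * bump xt r (f^[j] x) ∂ν ≤ p :=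
      integral_mono hprod hint fun x => mul_le_of_le_one_right (bump_nonneg _) (bump_le_one _)
    nlinarith
  have hle2 : c ≤ 9 / r ^ 2 * Θ j := by
    have h := hΘ.bound j _ _ (isBoundedLipschitz_bump (xt := xt) hr)
      (isBoundedLipschitz_bump (xt := xt) hr)
    have hl := lipNorm_bump_le (xt := xt) hr hr1
    have h3 : Θ j * lipNorm (bump xt r) * lipNorm (bump xt r) ≤ Θ j * (3 / r * (3 / r)) := by
      rw [mul_assoc]
      exact mul_le_mul_of_nonneg_left
        (mul_le_mul hl hl lipNorm_bump_nonneg (by positivity)) (hΘ.nonneg j)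
    refine (le_abs_self _).trans (h.trans (h3.trans_eq ?_))
    ring
  -- Interpolation `c = c ^ (1 - η) * c ^ η` needs `c > 0`; otherwise the nonnegative right side
  -- suffices.
  rcases le_or_gt c 0 with hc0 | hc0
  · exact hc0.trans (mul_nonneg (Real.rpow_nonneg hp.le _) (Real.rpow_nonneg hb0 _))
  · calc c = c ^ (1 - η) * c ^ η := by
          rw [← Real.rpow_add hc0, sub_add_cancel, Real.rpow_one]
      _ ≤ _ := mul_le_mul (Real.rpow_le_rpow hc0.le hle1 (by linarith))
          (Real.rpow_le_rpow hc0.le hle2 hη) (Real.rpow_nonneg hc0.le _)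
          (Real.rpow_nonneg hp.le _)

/-- The points whose first `n` iterates avoid the ball of radius `r` about `xt`. -/
def avoiding (f : X → X) (xt : X) (r : ℝ) (n : ℕ) : Set X :=
  {x | ∀ i < n, r ≤ dist (f^[i] x) xt}

/-- Chebyshev's inequality: on the avoiding set the cutoff vanishes along the orbit. The factor `p ^
(1 - η) / p ^ 2` gives the power `-(1 + η)`, and `18` bounds `2 * 9 ^ η`. -/
lemma measureReal_avoiding_le (hf : MeasurePreserving f ν ν) (hΘ : DecayOfCorrelations f ν Θ)
    {r : ℝ} (hr : 0 < r) (hr1 : r ≤ 1) {η : ℝ} (hη : 0 ≤ η) (hη1 : η ≤ 1)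
    (hq : 0 < ν.real (Metric.ball xt (r / 2))) {n : ℕ} (hn : 0 < n) :
    ν.real (avoiding f xt r n) ≤ 18 * (n : ℝ)⁻¹ * r ^ (-2 * η) *
      ν.real (Metric.ball xt (r / 2)) ^ (-(1 + η)) * ∑ j ∈ Finset.range n, Θ j ^ η := by
  have hqp := measureReal_ball_le_integral_bump (ν := ν) (xt := xt) hr
  have hp := hq.trans_le hqp
  have hcov := fun j => integral_bump_sub_mul_le hf hΘ hr hr1 hη hη1 j hp
  set p := ∫ x, bump xt r x ∂ν with hpdef
  have hp1 : p ≤ 1 := by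
    have := integral_mono (integrable_bump (ν := ν) (xt := xt) hr) (integrable_const (1 : ℝ))
      fun x => bump_le_one x
    simpa using this
  have hn' : (0 : ℝ) < n := by exact_mod_cast hn
  let g : X → ℝ := fun x => bump xt r x - p
  have hg : Measurable g := (continuous_bump hr).measurable.sub_const p
  have hgM : ∀ x, |g x| ≤ 1 := fun x => by
    have h1 := bump_nonneg (xt := xt) (r := r) x
    have h2 := bump_le_one (xt := xt) (r := r) x
    simp only [g, abs_le]
    constructor <;> linarith
  have hD0 : ∀ j, 0 ≤ p ^ (1 - η) * (9 / r ^ 2 * Θ j) ^ η := fun j =>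
    mul_nonneg (Real.rpow_nonneg hp.le _)
      (Real.rpow_nonneg (mul_nonneg (by positivity) (hΘ.nonneg j)) _)
  have hvar := integral_birkhoffSum_sq_le hf hg hgM hD0 hcov n
  have hBmeas : Measurable (birkhoffSum f g n) :=
    Finset.measurable_sum _ fun j _ => hg.comp (hf.measurable.iterate j)
  have hBint : Integrable (fun x => birkhoffSum f g n x ^ 2) ν := by
    refine Integrable.of_bound (hBmeas.pow_const 2).aestronglyMeasurable ((n : ℝ) ^ 2)
      (ae_of_all _ fun x => ?_)
    rw [norm_pow]
    refine pow_le_pow_left₀ (norm_nonneg _) ?_ 2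
    refine (Finset.abs_sum_le_sum_abs _ _).trans ?_
    refine (Finset.sum_le_card_nsmul _ _ 1 fun i _ => hgM _).trans_eq ?_
    simp
  have hsub : avoiding f xt r n ⊆ {x | (n * p) ^ 2 ≤ birkhoffSum f g n x ^ 2} := fun x hx => by
    have : birkhoffSum f g n x = -(n * p) := by
      rw [birkhoffSum, Finset.sum_congr rfl fun i hi => show g (f^[i] x) = -p by
        simp only [g, bump_eq_zero hr (hx i (Finset.mem_range.1 hi)), zero_sub]]
      simp
    rw [Set.mem_ofPred_eq, this, neg_sq]
  have hmarkov := mul_meas_ge_le_integral_of_nonneg (μ := ν)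
    (ae_of_all _ fun x => sq_nonneg (birkhoffSum f g n x)) hBint ((n * p) ^ 2)
  have hkey : (n * p) ^ 2 * ν.real (avoiding f xt r n)
      ≤ 2 * n * ∑ j ∈ Finset.range n, p ^ (1 - η) * (9 / r ^ 2 * Θ j) ^ η :=
    (mul_le_mul_of_nonneg_left (measureReal_mono hsub) (sq_nonneg _)).trans (hmarkov.trans hvar)
  have hsum : ∑ j ∈ Finset.range n, p ^ (1 - η) * (9 / r ^ 2 * Θ j) ^ η
      = p ^ (1 - η) * (9 ^ η * r ^ (-2 * η)) * ∑ j ∈ Finset.range n, Θ j ^ η := by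
    rw [Finset.mul_sum]
    refine Finset.sum_congr rfl fun j _ => ?_
    have hr2 : r ^ (-2 : ℝ) = (r ^ 2)⁻¹ := by
      rw [Real.rpow_neg hr.le, Real.rpow_two]
    rw [Real.mul_rpow (by positivity) (hΘ.nonneg j), div_eq_mul_inv,
      Real.mul_rpow (by positivity) (by positivity), Real.rpow_mul hr.le, hr2]
    ring
  rw [hsum] at hkey
  have hS : 0 ≤ ∑ j ∈ Finset.range n, Θ j ^ η :=
    Finset.sum_nonneg fun j _ => Real.rpow_nonneg (hΘ.nonneg j) _
  have h9 : (9 : ℝ) ^ η ≤ 9 := by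
    simpa using Real.rpow_le_rpow_of_exponent_le (by norm_num : (1 : ℝ) ≤ 9) hη1
  have hpp : p ^ (1 - η) = p ^ 2 * p ^ (-(1 + η)) := by
    rw [← Real.rpow_natCast, ← Real.rpow_add hp]
    congr 1
    push_cast
    ring
  have hpq : p ^ (-(1 + η)) ≤ ν.real (Metric.ball xt (r / 2)) ^ (-(1 + η)) :=
    Real.rpow_le_rpow_of_nonpos hq hqp (by linarith)
  have hrη : 0 ≤ r ^ (-2 * η) := Real.rpow_nonneg hr.le _
  have hpη : 0 ≤ p ^ (-(1 + η)) := Real.rpow_nonneg hp.le _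
  calc ν.real (avoiding f xt r n)
      ≤ 2 * (n : ℝ)⁻¹ * (9 ^ η * r ^ (-2 * η)) * p ^ (-(1 + η)) *
          ∑ j ∈ Finset.range n, Θ j ^ η := by
        rw [hpp] at hkey
        refine le_of_mul_le_mul_left (hkey.trans_eq ?_) (show 0 < (n * p) ^ 2 by positivity)
        field_simp
    _ ≤ 2 * (n : ℝ)⁻¹ * (9 * r ^ (-2 * η)) * ν.real (Metric.ball xt (r / 2)) ^ (-(1 + η)) *
          ∑ j ∈ Finset.range n, Θ j ^ η := by gcongr
    _ = _ := by ring

end HittingTime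

/-! ### Lower bounds under exponential and polynomial decay. -/

section LowerBound

variable {X : Type*} [MetricSpace X] [MeasurableSpace X]
  {f : X → X} {ν : Measure X} [IsProbabilityMeasure ν] {xt : X} {Θ : ℕ → ℝ} {d α : ℝ}

/-- Exponent count at radius `n ^ (-c)`: Chebyshev gains `1`, the correlation sum costs `τ`, the
small ball `c * D * (1 + η)`, and the Lipschitz norms `2 * η * c`. -/
lemma measureReal_avoiding_rpow_isBigO [OpensMeasurableSpace X]
    (hf : MeasurePreserving f ν ν)
    (hΘ : DecayOfCorrelations f ν Θ) (hdim : HasLocalDimension ν xt d)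
    {η τ K c D : ℝ} (hη : 0 ≤ η) (hη1 : η ≤ 1) (hc : 0 < c) (hD : d < D)
    (hsum : ∀ n : ℕ, ∑ j ∈ Finset.range n, Θ j ^ η ≤ K * (n : ℝ) ^ τ) :
    (fun n : ℕ => ν.real (avoiding f xt ((n : ℝ) ^ (-c)) n)) =O[atTop]
      fun n : ℕ => (n : ℝ) ^ (-(1 - τ - c * D * (1 + η) - 2 * η * c)) := by
  have hr : Tendsto (fun n : ℕ => (n : ℝ) ^ (-c) / 2) atTop (𝓝[>] 0) := by
    refine tendsto_nhdsWithin_iff.2 ⟨?_, ?_⟩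
    · simpa using ((tendsto_rpow_neg_atTop hc).comp tendsto_natCast_atTop_atTop).div_const 2
    · filter_upwards [eventually_gt_atTop 0] with n hn
      exact half_pos (Real.rpow_pos_of_pos (by exact_mod_cast hn) _)
  refine IsBigO.of_bound (18 * K * (2⁻¹ : ℝ) ^ (-(D * (1 + η)))) ?_
  filter_upwards [hr.eventually (hdim.rpow_le_ball hD), eventually_gt_atTop 0] with n hball hn
  have hn' : (0 : ℝ) < n := by exact_mod_cast hn
  have hr0 : 0 < (n : ℝ) ^ (-c) := Real.rpow_pos_of_pos hn' _
  have hr1 : (n : ℝ) ^ (-c) ≤ 1 :=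
    Real.rpow_le_one_of_one_le_of_nonpos (by exact_mod_cast hn) (by linarith)
  have hq := hdim.ball_pos _ (half_pos hr0)
  rw [Real.norm_of_nonneg measureReal_nonneg, Real.norm_of_nonneg (Real.rpow_nonneg hn'.le _)]
  have hS : 0 ≤ ∑ j ∈ Finset.range n, Θ j ^ η :=
    Finset.sum_nonneg fun j _ => Real.rpow_nonneg (hΘ.nonneg j) _
  have hqle : ν.real (Metric.ball xt ((n : ℝ) ^ (-c) / 2)) ^ (-(1 + η))
      ≤ (((n : ℝ) ^ (-c) / 2) ^ D) ^ (-(1 + η)) :=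
    Real.rpow_le_rpow_of_nonpos (Real.rpow_pos_of_pos (half_pos hr0) _) hball (by linarith)
  calc ν.real (avoiding f xt ((n : ℝ) ^ (-c)) n)
      ≤ 18 * (n : ℝ)⁻¹ * ((n : ℝ) ^ (-c)) ^ (-2 * η) *
          ν.real (Metric.ball xt ((n : ℝ) ^ (-c) / 2)) ^ (-(1 + η)) *
          ∑ j ∈ Finset.range n, Θ j ^ η := measureReal_avoiding_le hf hΘ hr0 hr1 hη hη1 hq hn
    _ ≤ 18 * (n : ℝ)⁻¹ * ((n : ℝ) ^ (-c)) ^ (-2 * η) *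
          (((n : ℝ) ^ (-c) / 2) ^ D) ^ (-(1 + η)) * (K * (n : ℝ) ^ τ) := by
        gcongr
        exact hsum n
    _ = 18 * K * (2⁻¹ : ℝ) ^ (-(D * (1 + η))) *
          ((n : ℝ) ^ (-1 : ℝ) * (n : ℝ) ^ (-c * (-2 * η)) * (n : ℝ) ^ (-c * (-(D * (1 + η)))) *
            (n : ℝ) ^ τ) := by
        rw [← Real.rpow_mul (half_pos hr0).le, mul_neg, div_eq_mul_inv,
          Real.mul_rpow hr0.le (by norm_num), ← Real.rpow_mul hn'.le, ← Real.rpow_mul hn'.le,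
          Real.rpow_neg_one]
        ring
    _ = _ := by
        rw [← Real.rpow_add hn', ← Real.rpow_add hn', ← Real.rpow_add hn']
        congr 2
        ring

/-- If the avoidance probabilities decay polynomially, then almost every orbit has eventually
large maxima. -/
lemma ae_eventually_le_maxProcess_of_isBigO (hα : 0 < α) {c κ s : ℝ} (hc : 0 < c) (hκ : 0 < κ)
    (hO : (fun n : ℕ => ν.real (avoiding f xt ((n : ℝ) ^ (-c)) n)) =O[atTop]
      fun n : ℕ => (n : ℝ) ^ (-κ)) (hs : s < c * α) :
    ∀ᵐ x ∂ν, ∀ᶠ n : ℕ in atTop,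
      (n : ℝ≥0∞) ^ s ≤ maxProcess f (powerDist xt α) n x := by
  -- As `κ` may be at most `1`, summing over all `n` could diverge; along powers of two the bound is
  -- geometric.
  have htwo : Tendsto (fun k : ℕ => 2 ^ k) atTop (atTop : Filter ℕ) :=
    tendsto_pow_atTop_atTop_of_one_lt one_lt_two
  have hsum : Summable fun k : ℕ =>
      ν.real (avoiding f xt (((2 ^ k : ℕ) : ℝ) ^ (-c)) (2 ^ k)) := by
    refine summable_of_isBigO_nat ?_ (hO.comp_tendsto htwo)
    have hgeom : Summable fun k : ℕ => ((2 : ℝ) ^ (-κ)) ^ k :=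
      summable_geometric_of_lt_one (by positivity)
        (Real.rpow_lt_one_of_one_lt_of_neg one_lt_two (neg_lt_zero.2 hκ))
    refine hgeom.congr fun k => ?_
    simp only [Function.comp, Nat.cast_pow, Nat.cast_ofNat]
    rw [← Real.rpow_natCast, ← Real.rpow_natCast, ← Real.rpow_mul zero_le_two,
      ← Real.rpow_mul zero_le_two, mul_comm]
  have hBC : ∀ᵐ x ∂ν, ∀ᶠ k : ℕ in atTop,
      x ∉ avoiding f xt (((2 ^ k : ℕ) : ℝ) ^ (-c)) (2 ^ k) := by
    refine ae_eventually_notMem ?_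
    have := hsum.tsum_ofReal_ne_top
    simpa only [measureReal_def, ENNReal.ofReal_toReal (measure_ne_top ν _)] using this
  have hlog : Tendsto (Nat.log 2) atTop atTop :=
    tendsto_atTop_atTop.2 fun b => ⟨2 ^ b, fun n hn =>
      Nat.le_log_of_pow_le one_lt_two hn⟩
  -- Passing from `n` to the largest power of two below it loses at most a factor `2`, absorbed by
  -- the strict inequality `s < c * α`.
  have hlarge : ∀ᶠ n : ℕ in atTop, (n : ℝ) ^ s ≤ ((n : ℝ) / 2) ^ (c * α) := by
    have hlim := (tendsto_rpow_atTop (sub_pos.2 hs)).comp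
      (tendsto_natCast_atTop_atTop (R := ℝ))
    filter_upwards [hlim.eventually_ge_atTop ((2 : ℝ) ^ (c * α)), eventually_gt_atTop 0]
      with n hn hn0
    have hn' : (0 : ℝ) < n := by exact_mod_cast hn0
    rw [Function.comp, Real.rpow_sub hn', le_div_iff₀ (Real.rpow_pos_of_pos hn' _)] at hn
    rw [Real.div_rpow hn'.le zero_le_two, le_div_iff₀ (by positivity), mul_comm]
    exact hn
  filter_upwards [hBC] with x hx
  filter_upwards [hlog.eventually hx, hlarge, eventually_gt_atTop 0] with n hn hns hn0
  have hn' : (0 : ℝ) < n := by exact_mod_cast hn0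
  simp only [avoiding, Set.mem_ofPred_eq, not_forall, not_le] at hn
  obtain ⟨i, hi, hdist⟩ := hn
  set N := 2 ^ Nat.log 2 n with hN
  have hNn : N ≤ n := Nat.pow_log_le_self 2 hn0.ne'
  have hnN : n < N * 2 := by
    rw [hN, ← pow_succ]
    exact Nat.lt_pow_succ_log_self one_lt_two n
  have hN0 : 0 < N := by positivity
  have h1 : (N : ℝ≥0∞) ^ (c * α) ≤ powerDist xt α (f^[i] x) := by
    refine le_powerDist hα hN0 ?_
    rw [mul_div_cancel_right₀ _ hα.ne']
    exact hdist.le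
  have h2 : (n : ℝ≥0∞) ^ s ≤ (N : ℝ≥0∞) ^ (c * α) := by
    rw [natCast_rpow_eq_ofReal hn0, natCast_rpow_eq_ofReal hN0]
    refine ENNReal.ofReal_le_ofReal (hns.trans ?_)
    refine Real.rpow_le_rpow (by positivity) ?_ (by positivity)
    rw [div_le_iff₀ two_pos]
    exact_mod_cast hnN.le
  exact h2.trans (h1.trans (le_maxProcess f _ x (hi.trans_le hNn)))

/-- Under exponential decay of correlations the maxima eventually exceed `n ^ s` for every
`s < α / d`. -/
theorem ae_eventually_le_maxProcess_of_exponential [OpensMeasurableSpace X]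
    (hf : MeasurePreserving f ν ν)
    (hΘ : DecayOfCorrelations f ν Θ) (hdim : HasLocalDimension ν xt d) (hd : 0 < d)
    (hα : 0 < α) {θ s : ℝ} (hθ : 0 < θ) (hθ1 : θ < 1)
    (hO : Θ =O[atTop] fun n : ℕ => θ ^ n) (hs : s < α / d) :
    ∀ᵐ x ∂ν, ∀ᶠ n : ℕ in atTop,
      (n : ℝ≥0∞) ^ s ≤ maxProcess f (powerDist xt α) n x := by
  -- The maximum with `0` keeps `c` positive when `s` is negative.
  obtain ⟨c, hc1, hc2⟩ : ∃ c, max 0 (s / α) < c ∧ c < 1 / d := by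
    refine exists_between (max_lt (by positivity) ?_)
    rw [div_lt_iff₀ hα, div_mul_eq_mul_div, one_mul]
    exact hs
  have hc : 0 < c := (le_max_left _ _).trans_lt hc1
  have hsc : s < c * α := (div_lt_iff₀ hα).1 ((le_max_right _ _).trans_lt hc1)
  have hcd : c * d < 1 := (lt_div_iff₀ hd).1 hc2
  -- At `η = 0` the exponent is `1 - c * d > 0`, so by continuity it stays positive for small `η`,
  -- with `D = d + η`.
  obtain ⟨η, hη, hη1, hκ⟩ : ∃ η : ℝ, 0 < η ∧ η ≤ 1 ∧
      0 < 1 - 0 - c * (d + η) * (1 + η) - 2 * η * c := by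
    have hcont : Continuous fun η : ℝ => 1 - 0 - c * (d + η) * (1 + η) - 2 * η * c := by fun_prop
    have h0 : ∀ᶠ η in 𝓝[>] (0 : ℝ), 0 < 1 - 0 - c * (d + η) * (1 + η) - 2 * η * c :=
      nhdsWithin_le_nhds (hcont.continuousAt.eventually (lt_mem_nhds (by simpa using hcd)))
    have h1 : ∀ᶠ η in 𝓝[>] (0 : ℝ), η ≤ 1 := nhdsWithin_le_nhds (Iic_mem_nhds one_pos)
    obtain ⟨η, ha, hb, hη⟩ := (h0.and (h1.and self_mem_nhdsWithin)).exists
    exact ⟨η, hη, hb, ha⟩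
  have hsummable : Summable fun j => Θ j ^ η := by
    have hgeom : Summable fun j : ℕ => (θ ^ η) ^ j :=
      summable_geometric_of_lt_one (by positivity) (Real.rpow_lt_one hθ.le hθ1 hη)
    refine summable_of_isBigO_nat hgeom ?_
    refine (hO.rpow hη.le (Eventually.of_forall fun n => pow_nonneg hθ.le n)).congr_right
      fun n => ?_
    rw [← Real.rpow_natCast, ← Real.rpow_natCast, ← Real.rpow_mul hθ.le, ← Real.rpow_mul hθ.le,
      mul_comm]
  refine ae_eventually_le_maxProcess_of_isBigO hα hc hκ
    (measureReal_avoiding_rpow_isBigO (K := ∑' j, Θ j ^ η) hf hΘ hdim hη.le hη1 hc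
      (lt_add_of_pos_right d hη) fun n => ?_) hsc
  rw [Real.rpow_zero, mul_one]
  exact hsummable.sum_le_tsum _ fun j _ => Real.rpow_nonneg (hΘ.nonneg j) _

/-- Under polynomial decay of correlations the maxima eventually exceed a fixed power of `n`. -/
theorem exists_ae_eventually_le_maxProcess_of_polynomial [OpensMeasurableSpace X]
    (hf : MeasurePreserving f ν ν)
    (hΘ : DecayOfCorrelations f ν Θ) (hdim : HasLocalDimension ν xt d) (hd : 0 < d)
    (hα : 0 < α) {ζ : ℝ} (hζ : 0 < ζ) (hO : Θ =O[atTop] fun n : ℕ => (n : ℝ) ^ (-ζ)) :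
    ∃ c : ℝ, 0 < c ∧ ∀ s < c * α, ∀ᵐ x ∂ν, ∀ᶠ n : ℕ in atTop,
      (n : ℝ≥0∞) ^ s ≤ maxProcess f (powerDist xt α) n x := by
  -- Chosen so that `ζ * p = ζ + 2 > 1`, making `Θ ^ p` summable for every `ζ > 0`; Hölder then
  -- bounds the sums of `Θ` by a multiple of `n ^ (1 - p⁻¹)`.
  set p : ℝ := 1 + 2 / ζ with hp
  have hp1 : 1 ≤ p := le_add_of_nonneg_right (by positivity)
  have hp0 : 0 < p := zero_lt_one.trans_le hp1
  have hsummable : Summable fun j => Θ j ^ p := by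
    have hexp : -ζ * p < -1 := by
      rw [hp]
      field_simp
      linarith
    refine summable_of_isBigO_nat (Real.summable_nat_rpow.2 hexp) ?_
    have hpos : ∀ᶠ n : ℕ in atTop, 0 ≤ (n : ℝ) ^ (-ζ) :=
      Eventually.of_forall fun n => Real.rpow_nonneg n.cast_nonneg _
    refine (hO.rpow hp0.le hpos).congr_right fun n => ?_
    rw [← Real.rpow_mul n.cast_nonneg]
  set K := ∑' j, Θ j ^ p
  have hsum : ∀ n : ℕ, ∑ j ∈ Finset.range n, Θ j ^ (1 : ℝ) ≤ K ^ p⁻¹ * (n : ℝ) ^ (1 - p⁻¹) := by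
    intro n
    simp only [Real.rpow_one]
    have h1 := Real.rpow_sum_le_const_mul_sum_rpow (Finset.range n) Θ hp1
    simp only [abs_of_nonneg (hΘ.nonneg _), Finset.card_range] at h1
    have hK : ∑ j ∈ Finset.range n, Θ j ^ p ≤ K :=
      hsummable.sum_le_tsum _ fun j _ => Real.rpow_nonneg (hΘ.nonneg j) _
    have hK0 : 0 ≤ K := tsum_nonneg fun j => Real.rpow_nonneg (hΘ.nonneg j) _
    have hS : 0 ≤ ∑ j ∈ Finset.range n, Θ j := Finset.sum_nonneg fun j _ => hΘ.nonneg j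
    have hn0 : 0 ≤ (n : ℝ) ^ (p - 1) := Real.rpow_nonneg n.cast_nonneg _
    have h2 := h1.trans (mul_le_mul_of_nonneg_left hK hn0)
    refine ((Real.le_rpow_inv_iff_of_pos hS (mul_nonneg hn0 hK0) hp0).2 h2).trans_eq ?_
    rw [Real.mul_rpow hn0 hK0, ← Real.rpow_mul n.cast_nonneg, mul_comm, sub_mul,
      mul_inv_cancel₀ hp0.ne', one_mul]
  -- With `η = 1` and `D = d + 1` the total cost `2 * c * (d + 2)` is half of the available `p⁻¹`.
  refine ⟨p⁻¹ / (4 * (d + 2)), by positivity, fun s hs => ?_⟩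
  have hκ : 0 < 1 - (1 - p⁻¹) - p⁻¹ / (4 * (d + 2)) * (d + 1) * (1 + 1)
      - 2 * 1 * (p⁻¹ / (4 * (d + 2))) := by
    have : 1 - (1 - p⁻¹) - p⁻¹ / (4 * (d + 2)) * (d + 1) * (1 + 1)
      - 2 * 1 * (p⁻¹ / (4 * (d + 2))) = p⁻¹ / 2 := by
      field_simp
      ring
    rw [this]
    positivity
  exact ae_eventually_le_maxProcess_of_isBigO hα (by positivity) hκ
    (measureReal_avoiding_rpow_isBigO hf hΘ hdim zero_le_one le_rfl (by positivity)
      (lt_add_one d) hsum) hs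

end LowerBound

end AlmostSureMaxima

theorem theorem2p3 {m : ℕ} {X : Set (EuclideanSpace ℝ (Fin m))}
    (f : X → X) (ν : Measure X) [IsProbabilityMeasure ν] (hf : Ergodic f ν)
    (xt : X) (dν : ℝ) (hdim : AlmostSureMaxima.HasLocalDimension ν xt dν) (hdν : 0 < dν)
    (δ : ℝ) (hA2 : AlmostSureMaxima.AnnulusRegular ν xt δ)
    (Θ : ℕ → ℝ) (hA1 : AlmostSureMaxima.DecayOfCorrelations f ν Θ)
    (α : ℝ) (hα : 0 < α) :
    ((∃ θ₀ : ℝ, 0 < θ₀ ∧ θ₀ < 1 ∧ Θ =O[atTop] fun n : ℕ => θ₀ ^ n) →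
      ∀ ε : ℝ, 0 < ε → ∀ᵐ x ∂ν, ∀ᶠ n : ℕ in atTop,
        (n : ℝ≥0∞) ^ (α / dν - ε) ≤
            AlmostSureMaxima.maxProcess f (AlmostSureMaxima.powerDist xt α) n x ∧
          AlmostSureMaxima.maxProcess f (AlmostSureMaxima.powerDist xt α) n x ≤
            (n : ℝ≥0∞) ^ (α / dν + ε)) ∧
    (∀ ζ : ℝ, 2 / δ < ζ → (Θ =O[atTop] fun n : ℕ => (n : ℝ) ^ (-ζ)) →
      ∃ β : ℝ, 0 < β ∧ ∀ ε : ℝ, 0 < ε → ∀ᵐ x ∂ν, ∀ᶠ n : ℕ in atTop,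
        (n : ℝ≥0∞) ^ (β * α / dν - ε) ≤
            AlmostSureMaxima.maxProcess f (AlmostSureMaxima.powerDist xt α) n x ∧
          AlmostSureMaxima.maxProcess f (AlmostSureMaxima.powerDist xt α) n x ≤
            (n : ℝ≥0∞) ^ (α / dν + ε)) := by
  have hup : ∀ ε : ℝ, 0 < ε → ∀ᵐ x ∂ν, ∀ᶠ n : ℕ in atTop,
      AlmostSureMaxima.maxProcess f (AlmostSureMaxima.powerDist xt α) n x ≤
        (n : ℝ≥0∞) ^ (α / dν + ε) := fun ε hε =>
    AlmostSureMaxima.ae_eventually_maxProcess_le hf.toMeasurePreserving hdim hdν hα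
      (lt_add_of_pos_right _ hε)
  constructor
  · rintro ⟨θ, hθ, hθ1, hO⟩ ε hε
    filter_upwards [hup ε hε, AlmostSureMaxima.ae_eventually_le_maxProcess_of_exponential
      hf.toMeasurePreserving hA1 hdim hdν hα hθ hθ1 hO (sub_lt_self _ hε)] with x h1 h2
    exact h2.and h1
  · intro ζ hζ hO
    have hζ0 : 0 < ζ := (div_pos two_pos hA2.1).trans hζ
    obtain ⟨c, hc, hlow⟩ := AlmostSureMaxima.exists_ae_eventually_le_maxProcess_of_polynomial
      hf.toMeasurePreserving hA1 hdim hdν hα hζ0 hO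
    -- `β = c * dν` makes `β * α / dν` equal to the exponent `c * α` obtained above.
    refine ⟨c * dν, mul_pos hc hdν, fun ε hε => ?_⟩
    have heq : c * dν * α / dν = c * α := by field_simp
    rw [heq]
    filter_upwards [hup ε hε, hlow _ (sub_lt_self _ hε)] with x h1 h2
    exact h2.and h1
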